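/- Let $N>1$ be a natural number. Let $\mathbb{Q}_N=\{p/N^k : p\in\mathbb{Z},\,k\in\mathbb{N}\}$ (a discrete group), and let $\Xi_N$ be the set of real sequences $\alpha=(\alpha_n)_{n\in\mathbb{N}}$ such that $\alpha_0\in[0,1)$ and, for every $n$, $N\alpha_{n+1}=\alpha_n+k$ for some $k\in\{0,\dots,N-1\}$. For $\alpha\in\Xi_N$ let $$\Psi_\alpha\Big(\big(\tfrac{p_1}{N^{k_1}},\tfrac{p_2}{N^{k_2}}\big),\big(\tfrac{p_3}{N^{k_3}},\tfrac{p_4}{N^{k_4}}\big)\Big)=\exp(2i\pi\alpha_{k_1+k_4}p_1p_4),$$ and let the noncommutative solenoid $\mathscr{A}^{\mathscr{S}}_\alpha=C^*(\mathbb{Q}_N^2,\Psi_\alpha)$ be the twisted group C*-algebra, i.e. the universal unital C*-algebra generated by unitaries $W_x$ ($x\in\mathbb{Q}_N^2$) subject to $W_xW_y=\Psi_\alpha(x,y)W_{x+y}$. For $\theta\in[0,1)$ let the rotation algebra $A_\theta$ be the universal unital C*-algebra generated by two unitaries $U_\theta,V_\theta$ subject to $V_\theta U_\theta=e^{2i\pi\theta}U_\theta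 V_\theta$. **Theorem.** Let $\alpha\in\Xi_N$. For every $n\in\mathbb{N}$ there is a unique *-morphism $\varphi_n:A_{\alpha_{2n}}\to A_{\alpha_{2n+2}}$ with $\varphi_n(U_{\alpha_{2n}})=U_{\alpha_{2n+2}}^N$ and $\varphi_n(V_{\alpha_{2n}})=V_{\alpha_{2n+2}}^N$, and $\mathscr{A}^{\mathscr{S}}_\alpha$ is the inductive limit, in the category of C*-algebras and *-morphisms, of the sequence $$A_{\alpha_0}\xrightarrow{\varphi_0}A_{\alpha_2}\xrightarrow{\varphi_1}A_{\alpha_4}\xrightarrow{\varphi_2}\cdots .$$ That is, there are *-morphisms $\upsilon_n:A_{\alpha_{2n}}\to\mathscr{A}^{\mathscr{S}}_\alpha$ with $\upsilon_{n+1}\circ\varphi_n=\upsilon_n$ for all $n$, such that for every C*-algebra $B$ and all *-morphisms $\psi_n:A_{\alpha_{2n}}\to B$ with $\psi_{n+1}\circ\varphi_n=\psi_n$ for all $n$, there is a unique *-morphism $\Phi:\mathscr{A}^{\mathscr{S}}_\alpha\to B$ with $\Phi\circ\upsilon_n=\psi_n$ for all $n$. -/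

import Mathlib

noncomputable section

/-! ## Completion of a C*-seminormed *-algebra -/

namespace UniformSpace.Completion

variable {E : Type} [SeminormedRing E] [StarRing E]

/-- The involution of the completion is the continuous extension of the given one. -/
instance : Star (Completion E) := ⟨Completion.map (star : E → E)⟩

theorem continuous_star' : Continuous (star : Completion E → Completion E) :=
  Completion.continuous_map

variable [NormedStarGroup E]

theorem star_coe (a : E) : star (a : Completion E) = ((star a : E) : Completion E) :=
  Completion.map_coe (starNormedAddGroupHom : NormedAddGroupHom E E).uniformContinuous a

instance : StarRing (Completion E) where
  star_involutive a := by
    refine Completion.induction_on a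
      (isClosed_eq (continuous_star'.comp continuous_star') continuous_id) fun x => ?_
    rw [star_coe, star_coe, star_star]
  star_mul a b := by
    refine Completion.induction_on₂ a b (isClosed_eq (continuous_star'.comp continuous_mul)
      ((continuous_star'.comp continuous_snd).mul (continuous_star'.comp continuous_fst)))
      fun x y => ?_
    rw [← coe_mul, star_coe, star_coe, star_coe, ← coe_mul, star_mul]
  star_add a b := by
    refine Completion.induction_on₂ a b (isClosed_eq (continuous_star'.comp continuous_add)
      ((continuous_star'.comp continuous_fst).add (continuous_star'.comp continuous_snd)))
      fun x y => ?_
    rw [← coe_add, star_coe, star_coe, star_coe, ← coe_add, star_add]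

variable [NormedAlgebra ℂ E] [StarModule ℂ E]

instance : NormedAlgebra ℂ (Completion E) where
  norm_smul_le := norm_smul_le

instance : StarModule ℂ (Completion E) where
  star_smul c a := by
    refine Completion.induction_on a
      (isClosed_eq (continuous_star'.comp (continuous_const_smul c))
        (continuous_star'.const_smul (star c))) fun x => ?_
    rw [← coe_smul, star_coe, star_coe, star_smul, coe_smul]

/-- The completion of a *-algebra for a C*-seminorm is a C*-algebra. -/
abbrev cstarAlgebra (h : ∀ a : E, ‖a‖ * ‖a‖ ≤ ‖star a * a‖) : CStarAlgebra (Completion E) where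
  norm_mul_self_le a := by
    refine Completion.induction_on a (isClosed_le (continuous_norm.mul continuous_norm)
      (continuous_norm.comp (continuous_star'.mul continuous_id))) fun x => ?_
    rw [star_coe, ← coe_mul, norm_coe, norm_coe]
    exact h x

end UniformSpace.Completion

/-! ## Universal C*-algebras generated by unitaries subject to relations -/

/-- The group algebra of the free group on `X`: the free unital complex *-algebra on a family of
unitaries indexed by `X`. -/
abbrev FreeUnitaryAlgebra (X : Type) : Type := MonoidAlgebra ℂ (FreeGroup X)

namespace FreeUnitaryAlgebra

variable {X : Type}

/-- The canonical generator attached to `x`. -/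
def gen (x : X) : FreeUnitaryAlgebra X := MonoidAlgebra.of ℂ (FreeGroup X) (FreeGroup.of x)

/-- Evaluation of *-polynomials at a family of unitaries of a C*-algebra. -/
def eval {B : Type} [CStarAlgebra B] (u : X → unitary B) : FreeUnitaryAlgebra X →ₐ[ℂ] B :=
  MonoidAlgebra.lift ℂ B (FreeGroup X) ((unitary B).subtype.comp (FreeGroup.lift u))

theorem eval_of {B : Type} [CStarAlgebra B] (u : X → unitary B) (g : FreeGroup X) :
    eval u (MonoidAlgebra.of ℂ (FreeGroup X) g) = (FreeGroup.lift u g : B) := by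
  simp [eval]

/-- Inversion of group elements, as a homomorphism to the opposite of the group algebra. -/
def invHom (X : Type) : FreeGroup X →* (FreeUnitaryAlgebra X)ᵐᵒᵖ where
  toFun g := MulOpposite.op (MonoidAlgebra.of ℂ (FreeGroup X) g⁻¹)
  map_one' := by rw [inv_one, map_one, MulOpposite.op_one]
  map_mul' a b := by rw [mul_inv_rev, map_mul, MulOpposite.op_mul]

/-- The involution of the group algebra, as a ring homomorphism to the opposite ring: it conjugates
coefficients and inverts group elements. -/
def starHom (X : Type) : FreeUnitaryAlgebra X →+* (FreeUnitaryAlgebra X)ᵐᵒᵖ :=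
  (MonoidAlgebra.lift ℂ (FreeUnitaryAlgebra X)ᵐᵒᵖ (FreeGroup X) (invHom X) :
    FreeUnitaryAlgebra X →+* (FreeUnitaryAlgebra X)ᵐᵒᵖ).comp
    (MonoidAlgebra.mapRingHom (FreeGroup X) (starRingEnd ℂ))

theorem starHom_single (g : FreeGroup X) (c : ℂ) :
    starHom X (MonoidAlgebra.single g c) =
      MulOpposite.op (MonoidAlgebra.single g⁻¹ (starRingEnd ℂ c)) := by
  simp [starHom, invHom, ← MulOpposite.op_smul]

theorem starHom_of (g : FreeGroup X) :
    starHom X (MonoidAlgebra.of ℂ (FreeGroup X) g) =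
      MulOpposite.op (MonoidAlgebra.of ℂ (FreeGroup X) g⁻¹) := by
  simp [starHom_single]

theorem starHom_smul (c : ℂ) (a : FreeUnitaryAlgebra X) :
    (starHom X (c • a)).unop = star c • (starHom X a).unop := by
  induction a using MonoidAlgebra.induction_on generalizing c with
  | of g => simp [starHom_single]
  | add x y hx hy => rw [smul_add, map_add, map_add, MulOpposite.unop_add, MulOpposite.unop_add,
      hx, hy, smul_add]
  | smul d x hx => rw [smul_smul, hx, hx, smul_smul, star_mul']

theorem starHom_starHom (a : FreeUnitaryAlgebra X) :
    (starHom X (starHom X a).unop).unop = a := by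
  induction a using MonoidAlgebra.induction_on with
  | of g => rw [starHom_of, MulOpposite.unop_op, starHom_of]; simp
  | add x y hx hy => simp [hx, hy]
  | smul c x hx => rw [starHom_smul, starHom_smul, hx, star_star]

theorem eval_starHom {B : Type} [CStarAlgebra B] (u : X → unitary B) (a : FreeUnitaryAlgebra X) :
    eval u (starHom X a).unop = star (eval u a) := by
  induction a using MonoidAlgebra.induction_on with
  | of g => rw [starHom_of, MulOpposite.unop_op, eval_of, eval_of, map_inv]; rfl
  | add x y hx hy => simp [hx, hy]
  | smul c x hx => rw [starHom_smul, map_smul, map_smul, hx, star_smul]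

/-- A bound for the norm of a *-polynomial in unitaries, uniform in the unitaries. -/
theorem exists_norm_eval_le (a : FreeUnitaryAlgebra X) :
    ∃ C : ℝ, ∀ (B : Type) (_ : CStarAlgebra B) (u : X → unitary B), ‖eval u a‖ ≤ C := by
  induction a using MonoidAlgebra.induction_on with
  | of g =>
    refine ⟨1, fun B _ u => ?_⟩
    rw [eval_of]
    cases subsingleton_or_nontrivial B
    · rw [Subsingleton.elim ((FreeGroup.lift u g : unitary B) : B) 0]; simp
    · rw [CStarRing.norm_coe_unitary]
  | add x y hx hy =>
    obtain ⟨C, hC⟩ := hx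
    obtain ⟨D, hD⟩ := hy
    refine ⟨C + D, fun B _ u => ?_⟩
    rw [map_add]
    exact (norm_add_le _ _).trans (add_le_add (hC B _ u) (hD B _ u))
  | smul c x hx =>
    obtain ⟨C, hC⟩ := hx
    refine ⟨‖c‖ * C, fun B _ u => ?_⟩
    rw [map_smul, norm_smul]
    exact mul_le_mul_of_nonneg_left (hC B _ u) (norm_nonneg _)

/-- The norms of the values of `a` at all families of unitaries, in all unital C*-algebras, that
satisfy the relations `r = 0` for `r ∈ R`. (A C*-algebra generated by a family indexed by `X : Type`
is isomorphic to one whose underlying type lives in `Type`.) -/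
def normSet (R : Set (FreeUnitaryAlgebra X)) (a : FreeUnitaryAlgebra X) : Set ℝ :=
  {t | ∃ (B : Type) (_ : CStarAlgebra B) (u : X → unitary B),
    (∀ r ∈ R, eval u r = 0) ∧ t = ‖eval u a‖}

/-- The largest C*-seminorm on *-polynomials in unitaries satisfying the relations `R`. -/
def maxNorm (R : Set (FreeUnitaryAlgebra X)) (a : FreeUnitaryAlgebra X) : ℝ := sSup (normSet R a)

variable {R : Set (FreeUnitaryAlgebra X)}

theorem norm_eval_le {B : Type} [CStarAlgebra B] (u : X → unitary B) (hu : ∀ r ∈ R, eval u r = 0)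
    (a : FreeUnitaryAlgebra X) : ‖eval u a‖ ≤ maxNorm R a := by
  obtain ⟨C, hC⟩ := exists_norm_eval_le a
  refine le_csSup ⟨C, ?_⟩ ⟨B, _, u, hu, rfl⟩
  rintro t ⟨B', _, u', -, rfl⟩
  exact hC _ _ _

theorem maxNorm_nonneg (a : FreeUnitaryAlgebra X) : 0 ≤ maxNorm R a := by
  refine Real.sSup_nonneg ?_
  rintro t ⟨B, _, u, -, rfl⟩
  exact norm_nonneg _

theorem maxNorm_le {a : FreeUnitaryAlgebra X} {C : ℝ} (hC : 0 ≤ C)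
    (h : ∀ (B : Type) (_ : CStarAlgebra B) (u : X → unitary B), (∀ r ∈ R, eval u r = 0) →
      ‖eval u a‖ ≤ C) : maxNorm R a ≤ C := by
  refine Real.sSup_le ?_ hC
  rintro t ⟨B, _, u, hu, rfl⟩
  exact h B _ u hu

end FreeUnitaryAlgebra

open FreeUnitaryAlgebra

/-- The free algebra on unitaries indexed by `X`, to be given the maximal C*-seminorm relative to
the relations `R`. -/
def PreUniversalCStar {X : Type} (_R : Set (FreeUnitaryAlgebra X)) : Type := FreeUnitaryAlgebra X

namespace PreUniversalCStar

variable {X : Type} (R : Set (FreeUnitaryAlgebra X))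

instance : Ring (PreUniversalCStar R) := inferInstanceAs (Ring (FreeUnitaryAlgebra X))

instance : Algebra ℂ (PreUniversalCStar R) := inferInstanceAs (Algebra ℂ (FreeUnitaryAlgebra X))

instance : Norm (PreUniversalCStar R) := ⟨fun a => maxNorm R a⟩

theorem norm_def (a : PreUniversalCStar R) : ‖a‖ = maxNorm R a := rfl

instance : Star (PreUniversalCStar R) := ⟨fun a => (starHom X a).unop⟩

theorem star_def (a : PreUniversalCStar R) : star a = (starHom X a).unop := rfl

theorem core : SeminormedSpace.Core ℂ (PreUniversalCStar R) where
  norm_nonneg a := maxNorm_nonneg a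
  norm_smul c a := by
    simp only [norm_def]
    have key : ∀ (c : ℂ) (a : FreeUnitaryAlgebra X), maxNorm R (c • a) ≤ ‖c‖ * maxNorm R a := by
      intro c a
      refine maxNorm_le (mul_nonneg (norm_nonneg _) (maxNorm_nonneg a)) fun B _ u hu => ?_
      rw [map_smul, norm_smul]
      exact mul_le_mul_of_nonneg_left (norm_eval_le u hu a) (norm_nonneg _)
    refine le_antisymm (key c a) ?_
    rcases eq_or_ne c 0 with rfl | hc
    · simpa using maxNorm_nonneg _
    · have h : maxNorm R a ≤ ‖c⁻¹‖ * maxNorm R (c • a) :=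
        (congrArg (maxNorm R) (inv_smul_smul₀ hc a)).symm.le.trans (key c⁻¹ (c • a))
      rw [norm_inv] at h
      have hc' : 0 < ‖c‖ := norm_pos_iff.mpr hc
      calc ‖c‖ * maxNorm R a ≤ ‖c‖ * (‖c‖⁻¹ * maxNorm R (c • a)) :=
            mul_le_mul_of_nonneg_left h hc'.le
        _ = maxNorm R (c • a) := by rw [mul_inv_cancel_left₀ hc'.ne']
  norm_triangle a b := by
    simp only [norm_def]
    refine maxNorm_le (add_nonneg (maxNorm_nonneg a) (maxNorm_nonneg b)) fun B _ u hu => ?_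
    exact (congrArg norm (map_add (eval u) a b)).le.trans
      ((norm_add_le _ _).trans (add_le_add (norm_eval_le u hu a) (norm_eval_le u hu b)))

instance : SeminormedAddCommGroup (PreUniversalCStar R) := SeminormedAddCommGroup.ofCore (core R)

instance : SeminormedRing (PreUniversalCStar R) :=
  { (inferInstance : Ring (PreUniversalCStar R)),
    (inferInstance : SeminormedAddCommGroup (PreUniversalCStar R)) with
    norm_mul_le := fun a b => by
      refine maxNorm_le (mul_nonneg (maxNorm_nonneg a) (maxNorm_nonneg b)) fun B _ u hu => ?_
      exact (congrArg norm (map_mul (eval u) a b)).le.trans ((norm_mul_le _ _).trans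
        (mul_le_mul (norm_eval_le u hu a) (norm_eval_le u hu b) (norm_nonneg _)
          (maxNorm_nonneg a))) }

instance : NormedAlgebra ℂ (PreUniversalCStar R) where
  __ := (inferInstance : Algebra ℂ (PreUniversalCStar R))
  norm_smul_le c a := ((core R).norm_smul c a).le

instance : StarRing (PreUniversalCStar R) where
  star_involutive a := starHom_starHom a
  star_mul a b := congrArg MulOpposite.unop (map_mul (starHom X) a b)
  star_add a b := congrArg MulOpposite.unop (map_add (starHom X) a b)

instance : StarModule ℂ (PreUniversalCStar R) where
  star_smul c a := starHom_smul c a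

theorem norm_star_le (a : PreUniversalCStar R) : ‖star a‖ ≤ ‖a‖ := by
  simp only [norm_def]
  refine maxNorm_le (maxNorm_nonneg a) fun B _ u hu => ?_
  exact ((congrArg norm (eval_starHom u a)).trans (norm_star _)).le.trans (norm_eval_le u hu a)

instance : NormedStarGroup (PreUniversalCStar R) where
  norm_star_le a := norm_star_le R a

theorem norm_mul_self_le (a : PreUniversalCStar R) : ‖a‖ * ‖a‖ ≤ ‖star a * a‖ := by
  have h0 : 0 ≤ maxNorm R (star a * a : PreUniversalCStar R) := maxNorm_nonneg _
  have h : ‖a‖ ≤ Real.sqrt ‖star a * a‖ := by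
    simp only [norm_def]
    refine maxNorm_le (Real.sqrt_nonneg _) fun B _ u hu => Real.le_sqrt_of_sq_le ?_
    have h1 : eval u (star a * a : PreUniversalCStar R) = star (eval u a) * eval u a :=
      (map_mul (eval u) (starHom X a).unop a).trans
        (congrArg (· * eval u a) (eval_starHom u a))
    rw [sq, ← CStarRing.norm_star_mul_self, ← h1]
    exact norm_eval_le u hu _
  calc ‖a‖ * ‖a‖ ≤ Real.sqrt ‖star a * a‖ * Real.sqrt ‖star a * a‖ :=
        mul_le_mul h h (maxNorm_nonneg a) (Real.sqrt_nonneg _)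
    _ = ‖star a * a‖ := Real.mul_self_sqrt h0

end PreUniversalCStar

/-- The universal unital C*-algebra generated by unitaries indexed by `X` subject to the relations
`r = 0` for `r ∈ R`: the Hausdorff completion of the *-algebra of *-polynomials in the generators for
the largest C*-seminorm compatible with the relations. -/
abbrev UniversalCStar {X : Type} (R : Set (FreeUnitaryAlgebra X)) : Type :=
  UniformSpace.Completion (PreUniversalCStar R)

instance {X : Type} (R : Set (FreeUnitaryAlgebra X)) : CStarAlgebra (UniversalCStar R) :=
  UniformSpace.Completion.cstarAlgebra (PreUniversalCStar.norm_mul_self_le R)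

/-- The canonical generating unitary attached to `x`. -/
def UniversalCStar.gen {X : Type} (R : Set (FreeUnitaryAlgebra X)) (x : X) : UniversalCStar R :=
  ((show PreUniversalCStar R from FreeUnitaryAlgebra.gen x : PreUniversalCStar R) :
    UniformSpace.Completion (PreUniversalCStar R))

/-! ## Rotation algebras, twisted group C*-algebras, noncommutative solenoids -/

/-- The relation `V U = exp (2 i π θ) U V`, where `U` and `V` are the generators `0` and `1`. -/
def rotationRelations (θ : ℝ) : Set (FreeUnitaryAlgebra (Fin 2)) :=
  {gen 1 * gen 0 - Complex.exp (2 * Real.pi * Complex.I * θ) • (gen 0 * gen 1)}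

/-- The rotation algebra `A_θ`: the universal C*-algebra generated by two unitaries `U`, `V` with
`V U = exp (2 i π θ) U V`. -/
abbrev RotationAlgebra (θ : ℝ) : Type := UniversalCStar (rotationRelations θ)

namespace RotationAlgebra

/-- The first canonical unitary of `A_θ`. -/
def U (θ : ℝ) : RotationAlgebra θ := UniversalCStar.gen (rotationRelations θ) 0

/-- The second canonical unitary of `A_θ`. -/
def V (θ : ℝ) : RotationAlgebra θ := UniversalCStar.gen (rotationRelations θ) 1

end RotationAlgebra

/-- The relations `W_x W_y = σ(x, y) W_{x + y}`. -/
def twistedRelations {G : Type} [AddCommGroup G] (σ : G → G → ℂ) : Set (FreeUnitaryAlgebra G) :=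
  {r | ∃ x y : G, r = gen x * gen y - σ x y • gen (x + y)}

/-- The (full) twisted group C*-algebra `C*(G, σ)` of the discrete abelian group `G` for the
multiplier `σ`: the universal C*-algebra generated by unitaries `W_x`, `x ∈ G`, with
`W_x W_y = σ(x, y) W_{x + y}`. -/
abbrev TwistedGroupCStarAlgebra {G : Type} [AddCommGroup G] (σ : G → G → ℂ) : Type :=
  UniversalCStar (twistedRelations σ)

/-- The group `ℚ_N` of `N`-adic rationals `p / N ^ k`. -/
def NadicRationals (N : ℕ) : AddSubgroup ℚ where
  carrier := {q | ∃ (p : ℤ) (k : ℕ), q = p / (N : ℚ) ^ k}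
  zero_mem' := ⟨0, 0, by simp⟩
  add_mem' := by
    rintro a b ⟨p, k, rfl⟩ ⟨q, l, rfl⟩
    rcases eq_or_ne (N : ℚ) 0 with h | h
    · rcases Nat.eq_zero_or_pos k with rfl | hk
      · rcases Nat.eq_zero_or_pos l with rfl | hl
        · exact ⟨p + q, 0, by simp⟩
        · exact ⟨p, 0, by simp [h, hl.ne']⟩
      · exact ⟨q, l, by simp [h, hk.ne']⟩
    · refine ⟨p * N ^ l + q * N ^ k, k + l, ?_⟩
      push_cast
      rw [div_add_div _ _ (pow_ne_zero _ h) (pow_ne_zero _ h), pow_add]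
      ring
  neg_mem' := by
    rintro a ⟨p, k, rfl⟩
    exact ⟨-p, k, by push_cast; ring⟩

namespace NadicRationals

variable {N : ℕ}

/-- The numerator `p` in a chosen expression `x = p / N ^ k`. -/
def num (x : NadicRationals N) : ℤ := x.2.choose

/-- The exponent `k` in a chosen expression `x = p / N ^ k`. -/
def exponent (x : NadicRationals N) : ℕ := x.2.choose_spec.choose

theorem eq_num_div (x : NadicRationals N) : (x : ℚ) = num x / (N : ℚ) ^ exponent x :=
  x.2.choose_spec.choose_spec

end NadicRationals

/-- The set `Ξ_N` of sequences `ν` with `ν 0 ∈ [0, 1)` and, for all `n`,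
`N ν (n + 1) = ν n + k` for some `k ∈ {0, …, N - 1}`. -/
def Xi (N : ℕ) : Set (ℕ → ℝ) :=
  {ν | ν 0 ∈ Set.Ico (0 : ℝ) 1 ∧ ∀ n, ∃ k : ℕ, k < N ∧ (N : ℝ) * ν (n + 1) = ν n + k}

/-- The multiplier `Ψ_α` of `ℚ_N × ℚ_N`,
`Ψ_α ((p₁ / N ^ k₁, p₂ / N ^ k₂), (p₃ / N ^ k₃, p₄ / N ^ k₄)) = exp (2 i π α (k₁ + k₄) p₁ p₄)`.
For `α ∈ Ξ_N` the value does not depend on the expressions chosen, see `solenoidMultiplier_eq`. -/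
def solenoidMultiplier (N : ℕ) (α : ℕ → ℝ) (x y : NadicRationals N × NadicRationals N) : ℂ :=
  Complex.exp (2 * Real.pi * Complex.I *
    (α (NadicRationals.exponent x.1 + NadicRationals.exponent y.2) : ℂ) *
    (NadicRationals.num x.1 : ℂ) * (NadicRationals.num y.2 : ℂ))

theorem Xi.exists_pow_mul {N : ℕ} {α : ℕ → ℝ} (hα : α ∈ Xi N) (k j : ℕ) :
    ∃ m : ℤ, (N : ℝ) ^ j * α (k + j) = α k + m := by
  induction j with
  | zero => exact ⟨0, by simp⟩
  | succ j ih =>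
    obtain ⟨m, hm⟩ := ih
    obtain ⟨c, -, hc⟩ := hα.2 (k + j)
    refine ⟨m + N ^ j * c, ?_⟩
    rw [pow_succ, mul_assoc, ← add_assoc, hc, mul_add, hm]
    push_cast
    ring

theorem solenoidMultiplier_eq {N : ℕ} (hN : 1 < N) {α : ℕ → ℝ} (hα : α ∈ Xi N)
    (x y : NadicRationals N × NadicRationals N) (p₁ p₄ : ℤ) (k₁ k₄ : ℕ)
    (hx : (x.1 : ℚ) = p₁ / (N : ℚ) ^ k₁) (hy : (y.2 : ℚ) = p₄ / (N : ℚ) ^ k₄) :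
    solenoidMultiplier N α x y =
      Complex.exp (2 * Real.pi * Complex.I * (α (k₁ + k₄) : ℂ) * (p₁ : ℂ) * (p₄ : ℂ)) := by
  have hN0 : (N : ℚ) ≠ 0 := by exact_mod_cast (by omega : N ≠ 0)
  have hx' := (NadicRationals.eq_num_div x.1).symm.trans hx
  have hy' := (NadicRationals.eq_num_div y.2).symm.trans hy
  unfold solenoidMultiplier
  set p := NadicRationals.num x.1
  set q := NadicRationals.num y.2
  set k := NadicRationals.exponent x.1
  set l := NadicRationals.exponent y.2
  rw [div_eq_div_iff (pow_ne_zero _ hN0) (pow_ne_zero _ hN0)] at hx' hy'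
  have hx2 : (p : ℝ) * (N : ℝ) ^ k₁ = p₁ * (N : ℝ) ^ k := by exact_mod_cast hx'
  have hy2 : (q : ℝ) * (N : ℝ) ^ k₄ = p₄ * (N : ℝ) ^ l := by exact_mod_cast hy'
  obtain ⟨m, hm⟩ := Xi.exists_pow_mul hα (k + l) (k₁ + k₄)
  obtain ⟨m', hm'⟩ := Xi.exists_pow_mul hα (k₁ + k₄) (k + l)
  rw [add_comm (k₁ + k₄) (k + l)] at hm'
  rw [Complex.exp_eq_exp_iff_exists_int]
  refine ⟨m' * p₁ * p₄ - m * p * q, ?_⟩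
  have key : α (k + l) * p * q = α (k₁ + k₄) * p₁ * p₄ + (m' * p₁ * p₄ - m * p * q) := by
    have e1 : α (k + l) = (N : ℝ) ^ (k₁ + k₄) * α (k + l + (k₁ + k₄)) - m := by linarith
    have e2 : α (k₁ + k₄) = (N : ℝ) ^ (k + l) * α (k + l + (k₁ + k₄)) - m' := by linarith
    have e3 : (N : ℝ) ^ (k₁ + k₄) * p * q = (N : ℝ) ^ (k + l) * p₁ * p₄ := by
      calc (N : ℝ) ^ (k₁ + k₄) * p * q = (p * (N : ℝ) ^ k₁) * (q * (N : ℝ) ^ k₄) := by ring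
        _ = _ := by rw [hx2, hy2]; ring
    rw [e1, e2]
    linear_combination α (k + l + (k₁ + k₄)) * e3
  have key' : (α (k + l) : ℂ) * p * q = α (k₁ + k₄) * p₁ * p₄ + (m' * p₁ * p₄ - m * p * q) := by
    exact_mod_cast key
  push_cast
  linear_combination (2 * Real.pi * Complex.I) * key'

/-- The noncommutative solenoid `C*(ℚ_N × ℚ_N, Ψ_α)`. -/
abbrev NoncommutativeSolenoid (N : ℕ) (α : ℕ → ℝ) : Type :=
  TwistedGroupCStarAlgebra (solenoidMultiplier N α)

/-! ## Inductive limits of C*-algebras -/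

/-- `L`, with the *-morphisms `υ n : A n → L`, is the inductive limit of the sequence
`A 0 → A 1 → A 2 → ⋯` in the category of C*-algebras and *-morphisms (neither is required to be
unital). -/
structure IsCStarInductiveLimit {A : ℕ → Type} [∀ n, NonUnitalCStarAlgebra (A n)]
    (φ : ∀ n, A n →⋆ₙₐ[ℂ] A (n + 1)) {L : Type} [NonUnitalCStarAlgebra L]
    (υ : ∀ n, A n →⋆ₙₐ[ℂ] L) : Prop where
  compatible : ∀ n, (υ (n + 1)).comp (φ n) = υ n
  universal : ∀ (B : Type) [NonUnitalCStarAlgebra B] (ψ : ∀ n, A n →⋆ₙₐ[ℂ] B),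
    (∀ n, (ψ (n + 1)).comp (φ n) = ψ n) →
      ∃! Φ : L →⋆ₙₐ[ℂ] B, ∀ n, Φ.comp (υ n) = ψ n

end

/-! Both kinds of algebra are universal for unitaries subject to phase relations, so the theorem
reduces to a comparison of generators and relations.

In the solenoid, `W (0, 1/N^n)` and `W (1/N^n, 0)` satisfy the relation of `A_θ` with `θ = α (2 *
n)`: the two denominators `N^n` contribute `n + n` to the index of `α`. Since `1/N^n = N ·
1/N^(n+1)`, each of these unitaries is the `N`-th power of the next one, which is exactly what the
connecting maps prescribe. These maps exist because moving `V^N` past `U^N` multiplies the angle by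
`N^2`, and `N^2 α (2n+2)` equals `α (2n)` modulo `ℤ` (`Xi.exp_eq`).

Conversely, compatible morphisms on the `A_{α (2n)}` yield unitaries `u n`, `v n` with the same
relations. As `ℚ_N^2` is the increasing union of the groups `(N^(-n) ℤ)^2`, the products `u n ^ k *
v n ^ j` give a well-defined twisted representation of `ℚ_N^2` (`exists_solenoid_hom`). Uniqueness
holds because every `W x` lies in the image of some `A_{α (2n)}` (`exists_map_eq_W`).

The limit is taken over possibly non-unital algebras and morphisms, whereas the universal properties
need unital targets. The connecting maps are unital, so all `ψ n` send `1` to one projection `p`,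
and `B` may be replaced by the corner `p B p` (`exists_unital_corner`, `exists_unital_factor`). -/

noncomputable section

open FreeUnitaryAlgebra

/-! ## The universal property of universal C*-algebras -/

namespace UniversalCStar

variable {X : Type} (R : Set (FreeUnitaryAlgebra X))

/-- The canonical map from *-polynomials to the universal C*-algebra. -/
def ofPoly : FreeUnitaryAlgebra X →ₐ[ℂ] UniversalCStar R where
  toFun a := ((show PreUniversalCStar R from a : PreUniversalCStar R) :
    UniformSpace.Completion (PreUniversalCStar R))
  map_one' := UniformSpace.Completion.coe_one _
  map_mul' a b := UniformSpace.Completion.coe_mul (α := PreUniversalCStar R) a b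
  map_zero' := UniformSpace.Completion.coe_zero
  map_add' a b := UniformSpace.Completion.coe_add (α := PreUniversalCStar R) a b
  commutes' c := by
    rw [Algebra.algebraMap_eq_smul_one, Algebra.algebraMap_eq_smul_one]
    exact (UniformSpace.Completion.coe_smul (X := PreUniversalCStar R) c 1).trans
      (congrArg (c • ·) (UniformSpace.Completion.coe_one _))

theorem ofPoly_gen (x : X) : ofPoly R (FreeUnitaryAlgebra.gen x) = gen R x := rfl

theorem norm_ofPoly (a : FreeUnitaryAlgebra X) : ‖ofPoly R a‖ = maxNorm R a :=
  UniformSpace.Completion.norm_coe (E := PreUniversalCStar R) a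

theorem star_ofPoly (a : FreeUnitaryAlgebra X) :
    star (ofPoly R a) = ofPoly R (starHom X a).unop :=
  UniformSpace.Completion.star_coe (E := PreUniversalCStar R) a

theorem denseRange_ofPoly : DenseRange (ofPoly R) :=
  UniformSpace.Completion.denseRange_coe (α := PreUniversalCStar R)

/-- A relation evaluates to zero in every representation over which the maximal seminorm is a
supremum, and the completion is Hausdorff. -/
theorem ofPoly_eq_zero {r : FreeUnitaryAlgebra X} (hr : r ∈ R) : ofPoly R r = 0 := by
  rw [← norm_eq_zero, norm_ofPoly]
  refine le_antisymm (maxNorm_le le_rfl fun B _ u hu => ?_) (maxNorm_nonneg _)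
  rw [hu r hr, norm_zero]

theorem star_ofPoly_of (g : FreeGroup X) : star (ofPoly R (MonoidAlgebra.of ℂ _ g)) =
    ofPoly R (MonoidAlgebra.of ℂ _ g⁻¹) := by
  rw [star_ofPoly, starHom_of, MulOpposite.unop_op]

theorem gen_mem_unitary (x : X) : gen R x ∈ unitary (UniversalCStar R) := by
  rw [← ofPoly_gen, FreeUnitaryAlgebra.gen, Unitary.mem_iff, star_ofPoly_of, ← map_mul, ← map_mul,
    ← map_mul, ← map_mul, inv_mul_cancel, mul_inv_cancel, map_one, map_one]
  exact ⟨rfl, rfl⟩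

/-- The canonical generator attached to `x`, as an element of the unitary group. -/
def genUnitary (x : X) : unitary (UniversalCStar R) := ⟨gen R x, gen_mem_unitary R x⟩

variable {R}

/-- *-morphisms, unital or not, that agree on the generators are equal. -/
theorem hom_ext [Nonempty X] {B : Type} [NonUnitalCStarAlgebra B]
    {f g : UniversalCStar R →⋆ₙₐ[ℂ] B} (h : ∀ x, f (gen R x) = g (gen R x)) : f = g := by
  have hcf : Continuous f := AddMonoidHomClass.continuous_of_bound f 1 fun a => by
    simpa using NonUnitalStarAlgHom.norm_apply_le f a
  have hcg : Continuous g := AddMonoidHomClass.continuous_of_bound g 1 fun a => by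
    simpa using NonUnitalStarAlgHom.norm_apply_le g a
  have key : ∀ a, f (ofPoly R a) = g (ofPoly R a) := by
    intro a
    induction a using MonoidAlgebra.induction_on with
    | of w =>
      induction w using FreeGroup.induction_on with
      -- Unitality is not assumed, so agreement at `1` comes from `1 = w * star w` for a generator
      -- `w`. This needs `X` to be nonempty.
      | C1 =>
        obtain ⟨x⟩ := ‹Nonempty X›
        rw [map_one, map_one, ← Unitary.mul_star_self_of_mem (gen_mem_unitary R x), map_mul,
          map_mul, map_star, map_star, h]
      | of x => exact h x
      | inv_of x hx => rw [← star_ofPoly_of, map_star, map_star, hx]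
      | mul x y hx hy => rw [map_mul, map_mul, map_mul, map_mul, hx, hy]
    | add x y hx hy => rw [map_add, map_add, map_add, hx, hy]
    | smul c x hx => rw [map_smul, map_smul, map_smul, hx]
  exact DFunLike.coe_injective ((denseRange_ofPoly R).equalizer hcf hcg (funext key))

/-- The seminorm `maxNorm R` dominates `‖eval u ·‖` for each admissible family `u`, so `eval u` is
contractive and extends to the completion. -/
theorem exists_hom {B : Type} [CStarAlgebra B] (u : X → unitary B)
    (hu : ∀ r ∈ R, eval u r = 0) :
    ∃ f : UniversalCStar R →⋆ₐ[ℂ] B, ∀ x, f (gen R x) = u x := by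
  let e : PreUniversalCStar R →+* B := (eval u : FreeUnitaryAlgebra X →+* B)
  have he : Continuous e := AddMonoidHomClass.continuous_of_bound e 1 fun a => by
    rw [one_mul]
    exact norm_eval_le u hu a
  let F : UniversalCStar R →+* B := UniformSpace.Completion.extensionHom e he
  have hF : Continuous F := UniformSpace.Completion.continuous_extension
  have hFe : ∀ a, F (ofPoly R a) = eval u a :=
    fun a => UniformSpace.Completion.extensionHom_coe e he a
  refine ⟨{ F with
    commutes' := fun c => ?_
    map_star' := fun a => ?_ }, fun x => ?_⟩
  · change F _ = _
    rw [← (ofPoly R).commutes, hFe, AlgHom.commutes]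
  · change F (star a) = star (F a)
    refine (denseRange_ofPoly R).induction_on a
      (isClosed_eq (hF.comp continuous_star) (continuous_star.comp hF)) fun x => ?_
    rw [star_ofPoly, hFe, hFe, eval_starHom]
  · change F _ = _
    rw [← ofPoly_gen, hFe, FreeUnitaryAlgebra.gen, eval_of, FreeGroup.lift_apply_of]

end UniversalCStar

/-! ## Unital corners of C*-algebras -/

/-- The corner `p B p` of a self-adjoint element `p`. -/
def cornerSubalgebra {B : Type} [NonUnitalCStarAlgebra B] (p : B) (hp : IsSelfAdjoint p) :
    NonUnitalStarSubalgebra ℂ B where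
  carrier := {b | p * b = b ∧ b * p = b}
  zero_mem' := ⟨mul_zero _, zero_mul _⟩
  add_mem' := by
    rintro a b ⟨h1, h2⟩ ⟨h3, h4⟩
    exact ⟨by rw [mul_add, h1, h3], by rw [add_mul, h2, h4]⟩
  mul_mem' := by
    rintro a b ⟨h1, h2⟩ ⟨h3, h4⟩
    exact ⟨by rw [← mul_assoc, h1], by rw [mul_assoc, h4]⟩
  smul_mem' := by
    rintro c a ⟨h1, h2⟩
    exact ⟨by rw [mul_smul_comm, h1], by rw [smul_mul_assoc, h2]⟩
  star_mem' := by
    rintro a ⟨h1, h2⟩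
    refine ⟨?_, ?_⟩
    · nth_rw 1 [← hp.star_eq]
      rw [← star_mul, h2]
    · nth_rw 1 [← hp.star_eq]
      rw [← star_mul, h1]

/-- A C*-algebra with an identity element is a unital C*-algebra. -/
abbrev NonUnitalCStarAlgebra.toCStarAlgebra {C : Type} [h : NonUnitalCStarAlgebra C] (e : C)
    (h1 : ∀ a, e * a = a) (h2 : ∀ a, a * e = a) : CStarAlgebra C :=
  letI r : Ring C :=
    { h.toNonUnitalNormedRing.toNonUnitalRing with
      one := e
      one_mul := h1
      mul_one := h2 }
  letI a : Algebra ℂ C := Algebra.ofModule (smul_mul_assoc) (mul_smul_comm)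
  { h, r, a with
    norm_smul_le := norm_smul_le }

/-- This replaces a non-unital target by a unital one: the corner `p B p` of a projection `p` is a
C*-algebra with identity `p`. -/
theorem exists_unital_corner {B : Type} [NonUnitalCStarAlgebra B] (p : B) (hp : IsSelfAdjoint p)
    (hpp : p * p = p) :
    ∃ (C : Type) (_ : CStarAlgebra C) (ι : C →⋆ₙₐ[ℂ] B), Function.Injective ι ∧ ι 1 = p ∧
      ∀ b, p * b = b → b * p = b → ∃ c, ι c = b := by
  -- Closedness in norm makes the corner complete, hence a C*-algebra.
  have hcl : IsClosed (cornerSubalgebra p hp : Set B) :=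
    (isClosed_eq (continuous_const.mul continuous_id) continuous_id).inter
      (isClosed_eq (continuous_id.mul continuous_const) continuous_id)
  have := hcl
  let i := NonUnitalCStarAlgebra.toCStarAlgebra (C := cornerSubalgebra p hp) ⟨p, hpp, hpp⟩
    (fun a => Subtype.ext a.2.1) (fun a => Subtype.ext a.2.2)
  exact ⟨cornerSubalgebra p hp, i, NonUnitalStarSubalgebraClass.subtype (cornerSubalgebra p hp),
    Subtype.val_injective, rfl, fun b h1 h2 => ⟨⟨b, h1, h2⟩, rfl⟩⟩

/-- A *-morphism from a unital C*-algebra into `B` that maps `1` to `ι 1` factors through the corner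
`ι`. -/
theorem exists_unital_factor {A B C : Type} [CStarAlgebra A] [NonUnitalCStarAlgebra B]
    [CStarAlgebra C] {ι : C →⋆ₙₐ[ℂ] B} (hι : Function.Injective ι)
    (hs : ∀ b, ι 1 * b = b → b * ι 1 = b → ∃ c, ι c = b)
    (ψ : A →⋆ₙₐ[ℂ] B) (h1 : ψ 1 = ι 1) :
    ∃ f : A →⋆ₐ[ℂ] C, ∀ a, ι (f a) = ψ a := by
  -- The image of `ψ` lies in the corner because `ψ a = ψ 1 * ψ a = ψ a * ψ 1`. All algebraic
  -- identities for `f` below are then pulled back along the injective `ι`.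
  have h : ∀ a, ∃ c, ι c = ψ a := fun a =>
    hs _ (by rw [← h1, ← map_mul, one_mul]) (by rw [← h1, ← map_mul, mul_one])
  choose f hf using h
  have f1 : f 1 = 1 := hι (by rw [hf, h1])
  have fsmul : ∀ (c : ℂ) a, f (c • a) = c • f a := fun c a => hι (by
    rw [hf, map_smul, map_smul, hf])
  refine ⟨{
    toFun := f
    map_one' := f1
    map_mul' := fun a b => hι (by rw [hf, map_mul, map_mul, hf, hf])
    map_zero' := hι (by rw [hf, map_zero, map_zero])
    map_add' := fun a b => hι (by rw [hf, map_add, map_add, hf, hf])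
    commutes' := fun c => by
      rw [Algebra.algebraMap_eq_smul_one, Algebra.algebraMap_eq_smul_one, fsmul, f1]
    map_star' := fun a => hι (by rw [hf, map_star, map_star, hf]) }, hf⟩

/-! ## Groups generated by two elements with central commutator -/

/-- Conjugation is an automorphism, so it commutes with powers. Conjugating `u ^ k` by `v` produces
`c ^ k`; conjugating `v ^ j` by `u ^ (-k)` then produces `c ^ (j * k)`, as `c` is central for `u`
and `v`. -/
theorem zpow_mul_zpow_of_mul_eq {G : Type*} [Group G] {u v c : G} (hu : Commute c u)
    (hv : Commute c v) (h : v * u = c * (u * v)) (j k : ℤ) :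
    v ^ j * u ^ k = c ^ (j * k) * (u ^ k * v ^ j) := by
  have h1 : v * u ^ k * v⁻¹ = c ^ k * u ^ k := by
    rw [← conj_zpow, h, ← hu.mul_zpow]
    group
  have h2 : u ^ (-k) * v * u ^ k = c ^ k * v := by
    have h3 : v * u ^ k = c ^ k * u ^ k * v := by rw [← h1]; group
    rw [mul_assoc, h3, ((hu.zpow_zpow k k).eq), zpow_neg]
    group
  have h4 : u ^ (-k) * v ^ j * u ^ k = c ^ (j * k) * v ^ j := by
    have := conj_zpow (i := j) (a := u ^ (-k)) (b := v)
    rw [zpow_neg, inv_inv, ← zpow_neg, h2, (hv.zpow_left k).mul_zpow, ← zpow_mul,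
      mul_comm k j] at this
    exact this.symm
  have h5 : u ^ k * (u ^ (-k) * v ^ j * u ^ k) = v ^ j * u ^ k := by group
  rw [← h5, h4, ← mul_assoc, ← mul_assoc, (hu.zpow_zpow (j * k) k).eq]

/-! ## Unitaries that commute up to a phase -/

/-- The unitary `exp (2 i π t) • 1`. -/
def unitaryPhase (C : Type) [CStarAlgebra C] : Multiplicative ℝ →* unitary C :=
  MonoidHom.mk' (fun t => ⟨Complex.exp (2 * Real.pi * Complex.I * (t.toAdd : ℝ)) • 1, by
    rw [Unitary.mem_iff, star_smul, star_one, smul_mul_smul_comm, smul_mul_smul_comm, mul_one,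
      mul_comm, and_self, Complex.star_def, ← Complex.exp_conj, ← Complex.exp_add]
    simp [Complex.conj_ofNat]⟩) fun s t => Subtype.ext <| by
      change Complex.exp (2 * Real.pi * Complex.I * ((s * t).toAdd : ℝ)) • (1 : C) =
        (_ • (1 : C)) * (_ • (1 : C))
      rw [smul_mul_smul_comm, mul_one, ← Complex.exp_add, toAdd_mul, Complex.ofReal_add, mul_add]

theorem coe_unitaryPhase (C : Type) [CStarAlgebra C] (t : ℝ) :
    (unitaryPhase C (Multiplicative.ofAdd t) : C) =
      Complex.exp (2 * Real.pi * Complex.I * t) • 1 := rfl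

theorem unitaryPhase_commute {C : Type} [CStarAlgebra C] (t : Multiplicative ℝ) (u : unitary C) :
    Commute (unitaryPhase C t) u := Subtype.ext <| by
  change (_ • (1 : C)) * (u : C) = u * (_ • (1 : C))
  rw [smul_mul_assoc, one_mul, mul_smul_comm, mul_one]

/-- This is the preceding commutation rule in the unitary group, with the scalar phase of angle `θ`
as central element. -/
theorem zpow_mul_zpow_of_rotation {C : Type} [CStarAlgebra C] {u v : unitary C} {θ : ℝ}
    (h : (v : C) * u = Complex.exp (2 * Real.pi * Complex.I * θ) • ((u : C) * v)) (j k : ℤ) :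
    ((v ^ j : unitary C) : C) * (u ^ k : unitary C) =
      Complex.exp (2 * Real.pi * Complex.I * θ * j * k) •
        (((u ^ k : unitary C) : C) * (v ^ j : unitary C)) := by
  have h' : v * u = unitaryPhase C (Multiplicative.ofAdd θ) * (u * v) := Subtype.ext <| by
    change (v : C) * u = (_ • (1 : C)) * ((u : C) * v)
    rw [smul_mul_assoc, one_mul]
    exact h
  have := congrArg (Subtype.val : unitary C → C)
    (zpow_mul_zpow_of_mul_eq (unitaryPhase_commute _ _) (unitaryPhase_commute _ _) h' j k)
  rw [← map_zpow, ← ofAdd_zsmul] at this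
  refine this.trans ?_
  change ((unitaryPhase C (Multiplicative.ofAdd ((j * k) • θ)) : unitary C) : C) *
    (((u ^ k : unitary C) : C) * (v ^ j : unitary C)) = _
  rw [coe_unitaryPhase, smul_mul_assoc, one_mul]
  congr 2
  push_cast [zsmul_eq_mul]
  ring

/-! ## Universal properties of rotation algebras and of twisted group C*-algebras -/

namespace RotationAlgebra

/-- The first canonical generator, in the unitary group. -/
def unitaryU (θ : ℝ) : unitary (RotationAlgebra θ) := UniversalCStar.genUnitary _ 0

/-- The second canonical generator, in the unitary group. -/
def unitaryV (θ : ℝ) : unitary (RotationAlgebra θ) := UniversalCStar.genUnitary _ 1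

theorem coe_unitaryU (θ : ℝ) : (unitaryU θ : RotationAlgebra θ) = U θ := rfl

theorem V_mul_U (θ : ℝ) :
    V θ * U θ = Complex.exp (2 * Real.pi * Complex.I * θ) • (U θ * V θ) := by
  have h := UniversalCStar.ofPoly_eq_zero (rotationRelations θ) rfl
  rw [map_sub, map_smul, map_mul, map_mul, sub_eq_zero] at h
  exact h

theorem hom_ext {θ : ℝ} {B : Type} [NonUnitalCStarAlgebra B] {f g : RotationAlgebra θ →⋆ₙₐ[ℂ] B}
    (hU : f (U θ) = g (U θ)) (hV : f (V θ) = g (V θ)) : f = g :=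
  UniversalCStar.hom_ext (Fin.forall_fin_two.mpr ⟨hU, hV⟩)

theorem exists_hom {θ : ℝ} {C : Type} [CStarAlgebra C] (u v : unitary C)
    (h : (v : C) * u = Complex.exp (2 * Real.pi * Complex.I * θ) • ((u : C) * v)) :
    ∃ f : RotationAlgebra θ →⋆ₐ[ℂ] C, f (U θ) = u ∧ f (V θ) = v := by
  obtain ⟨f, hf⟩ := UniversalCStar.exists_hom (R := rotationRelations θ) ![u, v] (by
    rintro r rfl
    rw [map_sub, map_smul, map_mul, map_mul, gen, gen, eval_of, eval_of, FreeGroup.lift_apply_of,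
      FreeGroup.lift_apply_of, sub_eq_zero]
    exact h)
  exact ⟨f, hf 0, hf 1⟩

/-- Since `1 = U * star U`, the image of `1` is determined by that of `U`. A morphism not assumed
unital is thus unital once it sends `U` to a unitary. -/
theorem map_one_of_map_U {θ : ℝ} {C : Type} [CStarAlgebra C] (f : RotationAlgebra θ →⋆ₙₐ[ℂ] C)
    (u : unitary C) (h : f (U θ) = u) : f 1 = 1 := by
  rw [← Unitary.coe_mul_star_self (unitaryU θ), map_mul, Unitary.coe_star, map_star,
    coe_unitaryU, h, Unitary.mul_star_self_of_mem u.2]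

end RotationAlgebra

namespace TwistedGroupCStarAlgebra

variable {G : Type} [AddCommGroup G] (σ : G → G → ℂ)

/-- The canonical unitary `W_x`. -/
def W (x : G) : unitary (TwistedGroupCStarAlgebra σ) := UniversalCStar.genUnitary _ x

theorem W_mul_W (x y : G) :
    (W σ x : TwistedGroupCStarAlgebra σ) * W σ y = σ x y • ↑(W σ (x + y)) := by
  have h := UniversalCStar.ofPoly_eq_zero (twistedRelations σ) ⟨x, y, rfl⟩
  rw [map_sub, map_smul, map_mul, sub_eq_zero] at h
  exact h

variable {σ} in
theorem W_mul_W_of_eq_one {x y : G} (h : σ x y = 1) : W σ x * W σ y = W σ (x + y) :=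
  Subtype.ext <| (W_mul_W σ x y).trans (by rw [h, one_smul])

theorem exists_hom {C : Type} [CStarAlgebra C] (w : G → unitary C)
    (h : ∀ x y, (w x : C) * w y = σ x y • (w (x + y) : C)) :
    ∃ f : TwistedGroupCStarAlgebra σ →⋆ₐ[ℂ] C, ∀ x, f (W σ x) = w x :=
  UniversalCStar.exists_hom (R := twistedRelations σ) w (by
    rintro r ⟨x, y, rfl⟩
    rw [map_sub, map_smul, map_mul, gen, gen, gen, eval_of, eval_of, eval_of,
      FreeGroup.lift_apply_of, FreeGroup.lift_apply_of, FreeGroup.lift_apply_of, sub_eq_zero]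
    exact h x y)

end TwistedGroupCStarAlgebra

/-! ## `N`-adic rationals -/

namespace NadicRationals

/-- The element `p / N ^ k`. -/
def mk (N : ℕ) (p : ℤ) (k : ℕ) : NadicRationals N := ⟨p / (N : ℚ) ^ k, p, k, rfl⟩

variable {N : ℕ}

theorem coe_mk (p : ℤ) (k : ℕ) : (mk N p k : ℚ) = p / (N : ℚ) ^ k := rfl

theorem mk_add_mk (p q : ℤ) (k : ℕ) : mk N p k + mk N q k = mk N (p + q) k :=
  Subtype.ext <| by
    change (p / (N : ℚ) ^ k + q / (N : ℚ) ^ k : ℚ) = (p + q : ℤ) / (N : ℚ) ^ k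
    push_cast
    ring

theorem zsmul_mk_one (p : ℤ) (k : ℕ) : p • mk N 1 k = mk N p k :=
  Subtype.ext <| by
    change p • ((1 : ℤ) / (N : ℚ) ^ k : ℚ) = p / (N : ℚ) ^ k
    rw [zsmul_eq_mul]
    push_cast
    ring

theorem mk_mul_pow (hN : N ≠ 0) (p : ℤ) (k l : ℕ) : mk N (p * N ^ l) (k + l) = mk N p k :=
  Subtype.ext <| by
    have : (N : ℚ) ≠ 0 := by exact_mod_cast hN
    rw [coe_mk, coe_mk]
    push_cast
    rw [pow_add]
    field_simp

theorem mk_injective (hN : N ≠ 0) (k : ℕ) : Function.Injective fun p => mk N p k := by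
  intro p q h
  have h0 : (N : ℚ) ^ k ≠ 0 := pow_ne_zero _ (by exact_mod_cast hN)
  have h1 : (p / (N : ℚ) ^ k : ℚ) = q / (N : ℚ) ^ k := congrArg Subtype.val h
  exact_mod_cast (div_left_inj' h0).mp h1

theorem exists_eq_mk (hN : N ≠ 0) (x : NadicRationals N) {n : ℕ} (hn : exponent x ≤ n) :
    ∃ p, x = mk N p n := by
  obtain ⟨l, rfl⟩ := Nat.exists_eq_add_of_le hn
  exact ⟨num x * N ^ l, by rw [mk_mul_pow hN]; exact Subtype.ext (eq_num_div x)⟩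

end NadicRationals

/-! ## Noncommutative solenoids -/

open NadicRationals TwistedGroupCStarAlgebra

section Solenoid

variable {N : ℕ} {α : ℕ → ℝ}

/-- With common denominator `N ^ n` the index of `α` is `n + n`; hence only even indices appear in
the inductive sequence. -/
theorem solenoidMultiplier_mk (hN : 1 < N) (hα : α ∈ Xi N) (j k j' k' : ℤ) (n : ℕ) :
    solenoidMultiplier N α (mk N j n, mk N k n) (mk N j' n, mk N k' n) =
      Complex.exp (2 * Real.pi * Complex.I * (α (2 * n) : ℝ) * j * k') := by
  rw [two_mul n]
  exact solenoidMultiplier_eq hN hα _ _ _ _ _ _ rfl rfl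

/-- The multiplier only involves the first coordinate of `x` and the second of `y`. It is therefore
trivial on each coordinate axis, where `W` becomes a group homomorphism. -/
theorem solenoidMultiplier_fst_zero (hN : 1 < N) (hα : α ∈ Xi N) (b : NadicRationals N)
    (y : NadicRationals N × NadicRationals N) : solenoidMultiplier N α (0, b) y = 1 := by
  rw [solenoidMultiplier_eq hN hα (0, b) y 0 (num y.2) 0 (exponent y.2) (by simp)
    (eq_num_div _)]
  simp

theorem solenoidMultiplier_snd_zero (hN : 1 < N) (hα : α ∈ Xi N) (a : NadicRationals N)
    (x : NadicRationals N × NadicRationals N) : solenoidMultiplier N α x (a, 0) = 1 := by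
  rw [solenoidMultiplier_eq hN hα x (a, 0) (num x.1) 0 (exponent x.1) 0 (eq_num_div _)
    (by simp)]
  simp

theorem W_snd_mk (hN : 1 < N) (hα : α ∈ Xi N) (k : ℤ) (n : ℕ) :
    W (solenoidMultiplier N α) (0, mk N k n) =
      W (solenoidMultiplier N α) (0, mk N 1 n) ^ k := by
  let F : Multiplicative (NadicRationals N) →* unitary (NoncommutativeSolenoid N α) :=
    MonoidHom.mk' (fun b => W (solenoidMultiplier N α) (0, b.toAdd)) fun b b' => by
      rw [W_mul_W_of_eq_one (solenoidMultiplier_fst_zero hN hα _ _), Prod.mk_add_mk, add_zero,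
        toAdd_mul]
  rw [← zsmul_mk_one k n]
  exact map_zpow F (Multiplicative.ofAdd (mk N 1 n)) k

theorem W_fst_mk (hN : 1 < N) (hα : α ∈ Xi N) (j : ℤ) (n : ℕ) :
    W (solenoidMultiplier N α) (mk N j n, 0) =
      W (solenoidMultiplier N α) (mk N 1 n, 0) ^ j := by
  let F : Multiplicative (NadicRationals N) →* unitary (NoncommutativeSolenoid N α) :=
    MonoidHom.mk' (fun b => W (solenoidMultiplier N α) (b.toAdd, 0)) fun b b' => by
      rw [W_mul_W_of_eq_one (solenoidMultiplier_snd_zero hN hα _ _), Prod.mk_add_mk, add_zero,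
        toAdd_mul]
  rw [← zsmul_mk_one j n]
  exact map_zpow F (Multiplicative.ofAdd (mk N 1 n)) j

/-- The order of the factors matters: with the second coordinate on the left the multiplier is `1`,
while the opposite order would introduce a phase. -/
theorem W_mk (hN : 1 < N) (hα : α ∈ Xi N) (j k : ℤ) (n : ℕ) :
    W (solenoidMultiplier N α) (mk N j n, mk N k n) =
      W (solenoidMultiplier N α) (0, mk N 1 n) ^ k *
        W (solenoidMultiplier N α) (mk N 1 n, 0) ^ j := by
  rw [← W_snd_mk hN hα, ← W_fst_mk hN hα,
    W_mul_W_of_eq_one (solenoidMultiplier_fst_zero hN hα _ _), Prod.mk_add_mk, add_zero, zero_add]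

/-- Here `W (0, 1/N^n)` plays the role of `U` and `W (1/N^n, 0)` that of `V`. -/
theorem W_fst_mul_W_snd (hN : 1 < N) (hα : α ∈ Xi N) (n : ℕ) :
    (W (solenoidMultiplier N α) (mk N 1 n, 0) : NoncommutativeSolenoid N α) *
        W (solenoidMultiplier N α) (0, mk N 1 n) =
      Complex.exp (2 * Real.pi * Complex.I * (α (2 * n) : ℝ)) •
        ((W (solenoidMultiplier N α) (0, mk N 1 n) : NoncommutativeSolenoid N α) *
          W (solenoidMultiplier N α) (mk N 1 n, 0)) := by
  rw [W_mul_W, W_mul_W, solenoidMultiplier_fst_zero hN hα, one_smul, add_comm (0, mk N 1 n),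
    solenoidMultiplier_eq hN hα (mk N 1 n, 0) (0, mk N 1 n) 1 1 n n rfl rfl, two_mul n]
  simp

theorem mk_one_eq_mk_succ (hN : 1 < N) (n : ℕ) : mk N 1 n = mk N N (n + 1) := by
  simpa using (mk_mul_pow (N := N) (by omega) 1 n 1).symm

theorem W_snd_mk_succ_pow (hN : 1 < N) (hα : α ∈ Xi N) (n : ℕ) :
    W (solenoidMultiplier N α) (0, mk N 1 (n + 1)) ^ N =
      W (solenoidMultiplier N α) (0, mk N 1 n) := by
  rw [mk_one_eq_mk_succ hN n, W_snd_mk hN hα N, zpow_natCast]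

theorem W_fst_mk_succ_pow (hN : 1 < N) (hα : α ∈ Xi N) (n : ℕ) :
    W (solenoidMultiplier N α) (mk N 1 (n + 1), 0) ^ N =
      W (solenoidMultiplier N α) (mk N 1 n, 0) := by
  rw [mk_one_eq_mk_succ hN n, W_fst_mk hN hα N, zpow_natCast]

theorem exists_eq_mk_mk (hN : N ≠ 0) (x : NadicRationals N × NadicRationals N) {n : ℕ}
    (hn : exponent x.1 + exponent x.2 ≤ n) : ∃ j k, x = (mk N j n, mk N k n) := by
  obtain ⟨j, hj⟩ := exists_eq_mk hN x.1 (n := n) (by omega)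
  obtain ⟨k, hk⟩ := exists_eq_mk hN x.2 (n := n) (by omega)
  exact ⟨j, k, Prod.ext hj hk⟩

/-- Passing to a deeper level allows expressions with different denominators to be compared at a
common one. -/
theorem zpow_eq_zpow_of_pow_succ {G : Type*} [Group G] {u : ℕ → G}
    (hu : ∀ n, u (n + 1) ^ N = u n) (n : ℕ) (k : ℤ) (l : ℕ) :
    u n ^ k = u (n + l) ^ (k * N ^ l) := by
  induction l with
  | zero => simp
  | succ l ih =>
    rw [ih, ← hu (n + l), ← zpow_natCast, ← zpow_mul]
    congr 1
    ring

/-- Unitaries `u n`, `v n` with the relations of the rotation algebras, compatible with the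
connecting maps, define a *-morphism on the noncommutative solenoid. -/
theorem exists_solenoid_hom (hN : 1 < N) (hα : α ∈ Xi N) {C : Type} [CStarAlgebra C]
    {u v : ℕ → unitary C} (hu : ∀ n, u (n + 1) ^ N = u n) (hv : ∀ n, v (n + 1) ^ N = v n)
    (h : ∀ n, (v n : C) * u n =
      Complex.exp (2 * Real.pi * Complex.I * (α (2 * n) : ℝ)) • ((u n : C) * v n)) :
    ∃ f : NoncommutativeSolenoid N α →⋆ₐ[ℂ] C, ∀ n,
      f (W (solenoidMultiplier N α) (0, mk N 1 n)) = u n ∧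
      f (W (solenoidMultiplier N α) (mk N 1 n, 0)) = v n := by
  have hN0 : N ≠ 0 := by omega
  choose j k hjk using fun x : NadicRationals N × NadicRationals N =>
    exists_eq_mk_mk hN0 x le_rfl
  -- The sum of the two exponents bounds each of them, so both coordinates of `x` have denominator
  -- `N ^ d x`.
  let d (x : NadicRationals N × NadicRationals N) : ℕ := exponent x.1 + exponent x.2
  let w (x : NadicRationals N × NadicRationals N) : unitary C := u (d x) ^ k x * v (d x) ^ j x
  have lift : ∀ n l (j k : ℤ), u n ^ k * v n ^ j =
      u (n + l) ^ (k * N ^ l) * v (n + l) ^ (j * N ^ l) := fun n l j k => by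
    rw [← zpow_eq_zpow_of_pow_succ hu, ← zpow_eq_zpow_of_pow_succ hv]
  -- The value of `w` does not depend on the level: both expressions are lifted to level `d x + n`,
  -- where equal fractions have equal numerators.
  have hw : ∀ n (j k : ℤ), w (mk N j n, mk N k n) = u n ^ k * v n ^ j := by
    intro n j' k'
    set x := (mk N j' n, mk N k' n) with hx
    have e := (hjk x).symm.trans hx
    rw [← mk_mul_pow hN0 _ _ n, ← mk_mul_pow hN0 (k x) _ n, ← mk_mul_pow hN0 j' n (d x),
      ← mk_mul_pow hN0 k' n (d x), add_comm n (d x), Prod.mk.injEq] at e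
    have e1 := mk_injective hN0 _ e.1
    have e2 := mk_injective hN0 _ e.2
    change u (d x) ^ k x * v (d x) ^ j x = _
    rw [lift (d x) n, lift n (d x), add_comm n (d x)]
    exact congrArg₂ (fun a b : ℤ => u (d x + n) ^ a * v (d x + n) ^ b) e2 e1
  obtain ⟨f, hf⟩ := TwistedGroupCStarAlgebra.exists_hom (solenoidMultiplier N α) w (by
    intro x y
    obtain ⟨n, hxn, hyn⟩ : ∃ n, d x ≤ n ∧ d y ≤ n :=
      ⟨d x + d y, Nat.le_add_right _ _, Nat.le_add_left _ _⟩
    obtain ⟨j, k, rfl⟩ := exists_eq_mk_mk hN0 x hxn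
    obtain ⟨j', k', rfl⟩ := exists_eq_mk_mk hN0 y hyn
    rw [Prod.mk_add_mk, mk_add_mk, mk_add_mk, hw, hw, hw, solenoidMultiplier_mk hN hα]
    -- Only `v n ^ j` has to move past `u n ^ k'`; the phase this creates is the multiplier at level
    -- `n`.
    calc (((u n ^ k * v n ^ j : unitary C) : C)) * (u n ^ k' * v n ^ j' : unitary C)
        = (u n ^ k : unitary C) * (((v n ^ j : unitary C) : C) * (u n ^ k' : unitary C)) *
            (v n ^ j' : unitary C) := by
          simp only [Submonoid.coe_mul, mul_assoc]
      _ = _ := by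
          rw [zpow_mul_zpow_of_rotation (h n), mul_smul_comm, smul_mul_assoc, zpow_add, zpow_add]
          congr 1
          have : u n ^ k * u n ^ k' * (v n ^ j * v n ^ j') =
            u n ^ k * (u n ^ k' * v n ^ j) * v n ^ j' := by group
          rw [this]
          rfl)
  have zero_mk : ∀ n, (0 : NadicRationals N) = mk N 0 n := fun n => Subtype.ext (by simp [coe_mk])
  refine ⟨f, fun n => ⟨?_, ?_⟩⟩
  · rw [hf, zero_mk n, hw, zpow_one, zpow_zero, mul_one]
  · rw [hf, zero_mk n, hw, zpow_one, zpow_zero, one_mul]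

end Solenoid

/-! ## The connecting maps and the inductive limit -/

/-- Two steps of the recursion for `α` give `N ^ 2 * α (2n + 2) = α (2n) + m` with `m` an integer,
which the exponential does not see. -/
theorem Xi.exp_eq {N : ℕ} {α : ℕ → ℝ} (hα : α ∈ Xi N) (n : ℕ) :
    Complex.exp (2 * Real.pi * Complex.I * (α (2 * (n + 1)) : ℝ) * (N : ℤ) * (N : ℤ)) =
      Complex.exp (2 * Real.pi * Complex.I * (α (2 * n) : ℝ)) := by
  obtain ⟨m, hm⟩ := Xi.exists_pow_mul hα (2 * n) 2
  rw [Complex.exp_eq_exp_iff_exists_int]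
  refine ⟨m, ?_⟩
  have hm' : (N : ℂ) ^ 2 * (α (2 * (n + 1)) : ℝ) = (α (2 * n) : ℝ) + m := by exact_mod_cast hm
  push_cast
  linear_combination (2 * Real.pi * Complex.I) * hm'

theorem exists_connecting_hom {N : ℕ} {α : ℕ → ℝ} (hα : α ∈ Xi N) (n : ℕ) :
    ∃ φ : RotationAlgebra (α (2 * n)) →⋆ₐ[ℂ] RotationAlgebra (α (2 * (n + 1))),
      φ (RotationAlgebra.U (α (2 * n))) = RotationAlgebra.U (α (2 * (n + 1))) ^ N ∧
      φ (RotationAlgebra.V (α (2 * n))) = RotationAlgebra.V (α (2 * (n + 1))) ^ N := by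
  refine RotationAlgebra.exists_hom (RotationAlgebra.unitaryU (α (2 * (n + 1))) ^ N)
    (RotationAlgebra.unitaryV (α (2 * (n + 1))) ^ N) ?_
  have h := zpow_mul_zpow_of_rotation (u := RotationAlgebra.unitaryU (α (2 * (n + 1))))
    (v := RotationAlgebra.unitaryV (α (2 * (n + 1)))) (RotationAlgebra.V_mul_U _) N N
  rwa [Xi.exp_eq hα, zpow_natCast, zpow_natCast] at h

/-- The *-morphism from `A_{α (2 n)}` to the solenoid that maps `U` to `W (0, 1 / N ^ n)` and `V` to
`W (1 / N ^ n, 0)`. -/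
theorem exists_hom_to_solenoid {N : ℕ} (hN : 1 < N) {α : ℕ → ℝ} (hα : α ∈ Xi N) (n : ℕ) :
    ∃ υ : RotationAlgebra (α (2 * n)) →⋆ₐ[ℂ] NoncommutativeSolenoid N α,
      υ (RotationAlgebra.U (α (2 * n))) = W (solenoidMultiplier N α) (0, mk N 1 n) ∧
      υ (RotationAlgebra.V (α (2 * n))) = W (solenoidMultiplier N α) (mk N 1 n, 0) :=
  RotationAlgebra.exists_hom _ _ (W_fst_mul_W_snd hN hα n)

/-- This yields uniqueness in the limit: a morphism on the solenoid is determined by its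
compositions with the `υ n`. -/
theorem exists_map_eq_W {N : ℕ} (hN : 1 < N) {α : ℕ → ℝ} (hα : α ∈ Xi N)
    {υ : ∀ n, RotationAlgebra (α (2 * n)) →⋆ₐ[ℂ] NoncommutativeSolenoid N α}
    (hυ : ∀ n, υ n (RotationAlgebra.U (α (2 * n))) = W (solenoidMultiplier N α) (0, mk N 1 n) ∧
      υ n (RotationAlgebra.V (α (2 * n))) = W (solenoidMultiplier N α) (mk N 1 n, 0))
    (x : NadicRationals N × NadicRationals N) :
    ∃ n a, υ n a = W (solenoidMultiplier N α) x := by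
  obtain ⟨j, k, hx⟩ := exists_eq_mk_mk (by omega) x le_rfl
  generalize exponent x.1 + exponent x.2 = n at hx
  subst hx
  refine ⟨n, ((RotationAlgebra.unitaryU _ ^ k * RotationAlgebra.unitaryV _ ^ j :
    unitary (RotationAlgebra (α (2 * n)))) : RotationAlgebra (α (2 * n))), ?_⟩
  let F : unitary (RotationAlgebra (α (2 * n))) →* unitary (NoncommutativeSolenoid N α) :=
    Unitary.map (.ofClass (υ n))
  have hU : F (RotationAlgebra.unitaryU _) = W (solenoidMultiplier N α) (0, mk N 1 n) :=
    Subtype.ext (hυ n).1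
  have hV : F (RotationAlgebra.unitaryV _) = W (solenoidMultiplier N α) (mk N 1 n, 0) :=
    Subtype.ext (hυ n).2
  rw [W_mk hN hα, ← hU, ← hV, ← map_zpow, ← map_zpow, ← map_mul]
  rfl

/-- The factorization of a compatible sequence of *-morphisms through the solenoid. -/
theorem exists_solenoid_factor {N : ℕ} (hN : 1 < N) {α : ℕ → ℝ} (hα : α ∈ Xi N)
    {φ : ∀ n : ℕ, RotationAlgebra (α (2 * n)) →⋆ₙₐ[ℂ] RotationAlgebra (α (2 * (n + 1)))}
    (hφ : ∀ n : ℕ,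
      φ n (RotationAlgebra.U (α (2 * n))) = RotationAlgebra.U (α (2 * (n + 1))) ^ N ∧
      φ n (RotationAlgebra.V (α (2 * n))) = RotationAlgebra.V (α (2 * (n + 1))) ^ N)
    {B : Type} [NonUnitalCStarAlgebra B] (ψ : ∀ n, RotationAlgebra (α (2 * n)) →⋆ₙₐ[ℂ] B)
    (hψ : ∀ n, (ψ (n + 1)).comp (φ n) = ψ n) :
    ∃ Φ : NoncommutativeSolenoid N α →⋆ₙₐ[ℂ] B, ∀ n,
      Φ (W (solenoidMultiplier N α) (0, mk N 1 n)) = ψ n (RotationAlgebra.U (α (2 * n))) ∧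
      Φ (W (solenoidMultiplier N α) (mk N 1 n, 0)) = ψ n (RotationAlgebra.V (α (2 * n))) := by
  have hψ' : ∀ n a, ψ (n + 1) (φ n a) = ψ n a := fun n a => DFunLike.congr_fun (hψ n) a
  -- Each `φ n` maps `U` to a unitary and is therefore unital, so compatibility forces all `ψ n 1`
  -- to coincide. One corner then serves every `n`.
  have hone : ∀ n, ψ n 1 = ψ 0 1 := by
    intro n
    induction n with
    | zero => rfl
    | succ n ih =>
      rw [← ih, ← hψ' n 1,
        RotationAlgebra.map_one_of_map_U (φ n) (RotationAlgebra.unitaryU _ ^ N) (hφ n).1]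
  obtain ⟨C, _, ι, hι, hι1, hs⟩ := exists_unital_corner (ψ 0 1)
    (by rw [IsSelfAdjoint, ← map_star, star_one]) (by rw [← map_mul, one_mul])
  rw [← hι1] at hs
  choose f hf using fun n => exists_unital_factor hι hs (ψ n) ((hone n).trans hι1.symm)
  have hfφ : ∀ n a, f (n + 1) (φ n a) = f n a := fun n a => hι (by rw [hf, hf, hψ'])
  obtain ⟨Φ, hΦ⟩ := exists_solenoid_hom hN hα (C := C)
    (u := fun n => Unitary.map (.ofClass (f n)) (RotationAlgebra.unitaryU _))
    (v := fun n => Unitary.map (.ofClass (f n)) (RotationAlgebra.unitaryV _))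
    (fun n => Subtype.ext <| by
      change (f (n + 1) (RotationAlgebra.U _)) ^ N = f n (RotationAlgebra.U _)
      rw [← map_pow, ← (hφ n).1, hfφ])
    (fun n => Subtype.ext <| by
      change (f (n + 1) (RotationAlgebra.V _)) ^ N = f n (RotationAlgebra.V _)
      rw [← map_pow, ← (hφ n).2, hfφ])
    (fun n => by
      change f n (RotationAlgebra.V _) * f n (RotationAlgebra.U _) =
        _ • (f n (RotationAlgebra.U _) * f n (RotationAlgebra.V _))
      rw [← map_mul, ← map_mul, ← map_smul, RotationAlgebra.V_mul_U])
  refine ⟨ι.comp (Φ : NoncommutativeSolenoid N α →⋆ₙₐ[ℂ] C), fun n => ⟨?_, ?_⟩⟩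
  · exact (congrArg ι (hΦ n).1).trans (hf n _)
  · exact (congrArg ι (hΦ n).2).trans (hf n _)

theorem isCStarInductiveLimit_solenoid {N : ℕ} (hN : 1 < N) {α : ℕ → ℝ} (hα : α ∈ Xi N)
    {φ : ∀ n : ℕ, RotationAlgebra (α (2 * n)) →⋆ₙₐ[ℂ] RotationAlgebra (α (2 * (n + 1)))}
    (hφ : ∀ n : ℕ,
      φ n (RotationAlgebra.U (α (2 * n))) = RotationAlgebra.U (α (2 * (n + 1))) ^ N ∧
      φ n (RotationAlgebra.V (α (2 * n))) = RotationAlgebra.V (α (2 * (n + 1))) ^ N)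
    {υ : ∀ n, RotationAlgebra (α (2 * n)) →⋆ₐ[ℂ] NoncommutativeSolenoid N α}
    (hυ : ∀ n, υ n (RotationAlgebra.U (α (2 * n))) = W (solenoidMultiplier N α) (0, mk N 1 n) ∧
      υ n (RotationAlgebra.V (α (2 * n))) = W (solenoidMultiplier N α) (mk N 1 n, 0)) :
    IsCStarInductiveLimit (A := fun n => RotationAlgebra (α (2 * n))) φ
      fun n => (υ n : RotationAlgebra (α (2 * n)) →⋆ₙₐ[ℂ] NoncommutativeSolenoid N α) where
  compatible n := by
    refine RotationAlgebra.hom_ext ?_ ?_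
    · change υ (n + 1) (φ n _) = υ n _
      rw [(hφ n).1, map_pow, (hυ _).1, (hυ _).1, ← W_snd_mk_succ_pow hN hα n]
      rfl
    · change υ (n + 1) (φ n _) = υ n _
      rw [(hφ n).2, map_pow, (hυ _).2, (hυ _).2, ← W_fst_mk_succ_pow hN hα n]
      rfl
  universal B _ ψ hψ := by
    obtain ⟨Φ, hΦ⟩ := exists_solenoid_factor hN hα hφ ψ hψ
    have h : ∀ n, Φ.comp (υ n : RotationAlgebra (α (2 * n)) →⋆ₙₐ[ℂ] NoncommutativeSolenoid N α) =
        ψ n := fun n => RotationAlgebra.hom_ext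
      ((congrArg Φ (hυ n).1).trans (hΦ n).1) ((congrArg Φ (hυ n).2).trans (hΦ n).2)
    refine ⟨Φ, h, fun Φ' h' => UniversalCStar.hom_ext fun x => ?_⟩
    obtain ⟨n, a, ha⟩ := exists_map_eq_W hN hα hυ x
    change Φ' (W (solenoidMultiplier N α) x) = Φ (W (solenoidMultiplier N α) x)
    rw [← ha]
    exact DFunLike.congr_fun ((h' n).trans (h n).symm) a

end

theorem mainTheorem10 (N : ℕ) (hN : 1 < N) (α : ℕ → ℝ) (hα : α ∈ Xi N) :
    (∀ n : ℕ, ∃! φ : RotationAlgebra (α (2 * n)) →⋆ₙₐ[ℂ] RotationAlgebra (α (2 * (n + 1))),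
      φ (RotationAlgebra.U (α (2 * n))) = RotationAlgebra.U (α (2 * (n + 1))) ^ N ∧
      φ (RotationAlgebra.V (α (2 * n))) = RotationAlgebra.V (α (2 * (n + 1))) ^ N) ∧
    ∀ φ : ∀ n : ℕ, RotationAlgebra (α (2 * n)) →⋆ₙₐ[ℂ] RotationAlgebra (α (2 * (n + 1))),
      (∀ n : ℕ,
        φ n (RotationAlgebra.U (α (2 * n))) = RotationAlgebra.U (α (2 * (n + 1))) ^ N ∧
        φ n (RotationAlgebra.V (α (2 * n))) = RotationAlgebra.V (α (2 * (n + 1))) ^ N) →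
      ∃ υ : ∀ n : ℕ, RotationAlgebra (α (2 * n)) →⋆ₙₐ[ℂ] NoncommutativeSolenoid N α,
        IsCStarInductiveLimit (A := fun n => RotationAlgebra (α (2 * n))) φ υ := by
  constructor
  · intro n
    obtain ⟨φ, hφ⟩ := exists_connecting_hom hα n
    exact ⟨(φ : RotationAlgebra (α (2 * n)) →⋆ₙₐ[ℂ] RotationAlgebra (α (2 * (n + 1)))), hφ,
      fun φ' hφ' => RotationAlgebra.hom_ext (hφ'.1.trans hφ.1.symm) (hφ'.2.trans hφ.2.symm)⟩
  · intro φ hφ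
    choose υ hυ using exists_hom_to_solenoid hN hα
    exact ⟨_, isCStarInductiveLimit_solenoid hN hα hφ hυ⟩
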